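/- **Notation.** Number the edges of the complete graph on the nodes $1,2,3,4$ in the order $12,13,14,23,24,34$ and let $$B=\begin{bmatrix}1&1&1&0&0&0\\-1&0&0&1&1&0\\0&-1&0&-1&0&1\\0&0&-1&0&-1&-1\end{bmatrix},\qquad C=\begin{bmatrix}1&1&0&0\\0&0&1&1\end{bmatrix}.$$ For natural frequencies $\omega\in\mathbb R^4$ and edge weights $w\in\mathbb R^6$ the Kuramoto network with weights $w$ is $\dot x=\omega-B\,\mathrm{diag}(w)\sin(B^\top x)$, $t\ge 0$, with the measurement $y=Cx$; its topology is the graph of the edges of nonzero weight. Let $C^\dagger=C^\top(CC^\top)^{-1}$, $\mathbb 1=(1,1)^\top$, $M=I-\tfrac12\mathbb 1\mathbb 1^\top\in\mathbb R^{2\times 2}$, $M_C=C^\top MC$, $\|v\|_N=\sqrt{v^\top Nv}$, and put $$\kappa(x)=a_{13}\cos(x_1-x_3)+a_{24}\cos(x_2-x_4).$$ Outputs $y,\tilde y$ *become indistinguishable* with respect to $N$ if for every $\varepsilon>0$ there is $T>0$ with $\|y(t)-\tilde y(t)\|_N<\varepsilon$ for all $t>T$. The *symmetry condition* at $x$ is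 $a_{13}\cos(x_1-x_3)=a_{24}\cos(x_2-x_4)$. A trajectory $x$ is *$\pi/2$-phase cohesive* if $\|B^\top x(t)\|_\infty<\pi/2$ for all $t\ge0$. **Theorem.** Let $\omega\in\mathbb R^4$, $a_{12},a_{13},a_{24},a_{34}\in\mathbb R$, and $w=(a_{12},a_{13},0,0,a_{24},a_{34})$. 1. $M$ is positive semidefinite, and with $P=\begin{bmatrix}-1&1\\1&-1\end{bmatrix}$ one has $P^\top M+MP=-4M$. 2. If $a_{13},a_{24}>0$ and $\|B^\top x\|_\infty<\pi/2$, then $\kappa(x)>0$. 3. Let $\delta=(\delta_1,0,0,0,0,\delta_6)$ with $\delta_1,\delta_6\in\mathbb R$ arbitrary, let $f$ and $g$ be the vector fields with weights $w$ and $w+\delta$, and $\Delta=g-f$. Then $f$ and $\Delta$ are differentiable and $C\Delta(x)=0$ for all $x$. For all $s\in[0,1]$ and $x\in\mathbb R^4$, with $A=\frac{\partial f}{\partial x}+s\frac{\partial\Delta}{\partial x}$: * $CAC^\dagger=\tfrac12\kappa(x)\,P$; if $\kappa(x)>0$, this matrix has exactly one negative eigenvalue, and its nullspace is $\mathrm{span}(\mathbb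 1)$; * under the symmetry condition at $x$, $\mathcal N(C)\subseteq\mathcal N(CA)$; * if $\kappa(x)>0$ and the symmetry condition holds at $x$, then $A^\top M_C+M_CA\preceq-2\mu M_C$ for every $\mu\le\kappa(x)$. 4. Let $w'=w+\delta$ with $\delta$ as in 3, and let $x,\tilde x$ be trajectories on $[0,\infty)$ of the networks with weights $w$ and $w'$, with arbitrary initial conditions. Assume that either * (a) $a_{13},a_{24}>0$, and $x,\tilde x$ are both $\pi/2$-phase cohesive and satisfy the symmetry condition at all times $t\ge0$; or * (b) $x=X(\cdot,0)$ and $\tilde x=X(\cdot,1)$ where, for each $s\in[0,1]$, $X(\cdot,s)$ is a trajectory of the network with weights $w+s(w'-w)$ with initial condition $(1-s)x(0)+s\tilde x(0)$, and $\kappa>0$ and the symmetry condition hold at $X(t,s)$ for all $t\ge0$, $s\in[0,1]$. Then $y=Cx$ and $\tilde y=C\tilde x$ are indistinguishable up to a constant phase shift: they become indistinguishable with respect to $M$; if $\mu\in\mathbb R$ satisfies $\mu\le\kappa(x(t))$ and $\mu\le\kappa(\tilde x(t))$ for all $t\ge0$, then $\|y(t)-\tilde y(t)\|_M\le e^{-\mu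 t}\|y(0)-\tilde y(0)\|_M$ for all $t\ge0$; there is a constant $c\in\mathbb R$ such that $y$ and $\tilde y+c\mathbb 1$ become indistinguishable with respect to every positive definite $N$; and if $y(0)=\tilde y(0)$, then $y(t)=\tilde y(t)$ for all $t\ge0$. 5. Let $a_{12},a_{34}\ne0$ and $a_{13},a_{24}>0$. Of the four networks with weights $(a_{12},a_{13},0,0,a_{24},a_{34})$, $(0,a_{13},0,0,a_{24},a_{34})$, $(a_{12},a_{13},0,0,a_{24},0)$, $(0,a_{13},0,0,a_{24},0)$, the first three have a connected topology and the fourth a disconnected one, and the conclusion of 4, under (a) or (b), holds for any two of them (as $w$ and $w'$). -/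

import Mathlib

namespace KuramotoFour

noncomputable section

/-! ### General notions -/

/-- The norm (a seminorm if `M` is only positive semidefinite) `‖v‖_M = √(vᵀ M v)`. -/
def weightedNorm {p : ℕ} (M : Matrix (Fin p) (Fin p) ℝ) (v : Fin p → ℝ) : ℝ :=
  Real.sqrt (v ⬝ᵥ M.mulVec v)

/-- The outputs `y` and `y'` become indistinguishable with respect to `M`. -/
def BecomeIndistinguishable {p : ℕ} (M : Matrix (Fin p) (Fin p) ℝ)
    (y y' : ℝ → Fin p → ℝ) : Prop :=
  ∀ ε > 0, ∃ T > 0, ∀ t > T, weightedNorm M (y t - y' t) < ε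

/-- The Jacobian matrix of a map `ℝⁿ → ℝⁿ` (used only for differentiable maps). -/
def jacobian {n : ℕ} (f : (Fin n → ℝ) → (Fin n → ℝ)) (x : Fin n → ℝ) :
    Matrix (Fin n) (Fin n) ℝ :=
  LinearMap.toMatrix' (fderiv ℝ f x : (Fin n → ℝ) →ₗ[ℝ] (Fin n → ℝ))

/-- The pseudoinverse `C† = Cᵀ (C Cᵀ)⁻¹` of a matrix of full row rank. -/
def pseudoinverse {p n : ℕ} (C : Matrix (Fin p) (Fin n) ℝ) : Matrix (Fin n) (Fin p) ℝ :=
  C.transpose * (C * C.transpose)⁻¹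

/-- The matrix `I - (1/p) 𝟙 𝟙ᵀ` of size `p`. -/
def centering (p : ℕ) : Matrix (Fin p) (Fin p) ℝ :=
  1 - (1 / (p : ℝ)) • Matrix.vecMulVec (fun _ => 1) (fun _ => 1)

/-- The contraction inequality with rate `μ`, for the auxiliary system `ẋ = f x + s Δ x` with
output `C x`, at the state `x`, where `M_C = Cᵀ M C`. The matrix `M` is constant, so the term
`d/dt M_C` vanishes. -/
def ContractionLMI {p n : ℕ} (f Δ : (Fin n → ℝ) → (Fin n → ℝ)) (C : Matrix (Fin p) (Fin n) ℝ)
    (M : Matrix (Fin p) (Fin p) ℝ) (μ s : ℝ) (x : Fin n → ℝ) : Prop :=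
  let MC := C.transpose * M * C
  ((-2 * μ) • MC -
    ((jacobian f x).transpose * MC + MC * jacobian f x +
      s • ((jacobian Δ x).transpose * MC + MC * jacobian Δ x))).PosSemidef

/-! ### The four-oscillator network

The edges of the complete graph on the nodes `1, 2, 3, 4` (here `0, 1, 2, 3`) are ordered as
`12, 13, 14, 23, 24, 34`. -/

/-- The incidence matrix of the complete graph on four nodes. -/
def incidence : Matrix (Fin 4) (Fin 6) ℝ :=
  !![ 1,  1,  1,  0,  0,  0;
     -1,  0,  0,  1,  1,  0;
      0, -1,  0, -1,  0,  1;
      0,  0, -1,  0, -1, -1]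

/-- The measurement matrix. -/
def obs : Matrix (Fin 2) (Fin 4) ℝ :=
  !![1, 1, 0, 0;
     0, 0, 1, 1]

/-- Edge weights of a network whose only edges are among `12, 13, 24, 34`. -/
def weights (a12 a13 a24 a34 : ℝ) : Fin 6 → ℝ := ![a12, a13, 0, 0, a24, a34]

/-- The Kuramoto vector field `ω - B diag(w) sin(Bᵀ x)`. -/
def field (ω : Fin 4 → ℝ) (w : Fin 6 → ℝ) (x : Fin 4 → ℝ) : Fin 4 → ℝ :=
  ω - incidence.mulVec ((Matrix.diagonal w).mulVec
    (fun e => Real.sin (incidence.transpose.mulVec x e)))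

/-- The difference `Δ = g - f` of the vector fields with weights `w + δ` and `w`. -/
def fieldDiff (ω : Fin 4 → ℝ) (w δ : Fin 6 → ℝ) (x : Fin 4 → ℝ) : Fin 4 → ℝ :=
  field ω (w + δ) x - field ω w x

/-- `x` solves the Kuramoto equations with weights `w` for all times `t ≥ 0`. -/
def IsTrajectory (ω : Fin 4 → ℝ) (w : Fin 6 → ℝ) (x : ℝ → Fin 4 → ℝ) : Prop :=
  ∀ t, 0 ≤ t → HasDerivWithinAt x (field ω w (x t)) (Set.Ici 0) t

/-- The set `Θ(γ) = {x : ‖Bᵀ x‖_∞ < γ}`; the norm of `Fin 6 → ℝ` is the maximum norm. -/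
def Theta (γ : ℝ) : Set (Fin 4 → ℝ) :=
  {x | ‖incidence.transpose.mulVec x‖ < γ}

/-- The trajectory `x` is `γ`-phase cohesive. -/
def PhaseCohesive (γ : ℝ) (x : ℝ → Fin 4 → ℝ) : Prop :=
  ∀ t, 0 ≤ t → x t ∈ Theta γ

/-- The quantity `a₁₃ cos(x₁ - x₃) + a₂₄ cos(x₂ - x₄)`. -/
def coupling (a13 a24 : ℝ) (x : Fin 4 → ℝ) : ℝ :=
  a13 * Real.cos (x 0 - x 2) + a24 * Real.cos (x 1 - x 3)

/-- The symmetry condition `a₁₃ cos(x₁ - x₃) = a₂₄ cos(x₂ - x₄)`. -/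
def SymmetryCondition (a13 a24 : ℝ) (x : Fin 4 → ℝ) : Prop :=
  a13 * Real.cos (x 0 - x 2) = a24 * Real.cos (x 1 - x 3)

/-- The topology of the network with weights `w`: the edges of nonzero weight. -/
def topology (w : Fin 6 → ℝ) : SimpleGraph (Fin 4) where
  Adj i j := i ≠ j ∧ ∃ e, w e ≠ 0 ∧ incidence i e ≠ 0 ∧ incidence j e ≠ 0
  symm := ⟨fun _ _ h => ⟨h.1.symm, h.2.imp fun _ he => ⟨he.1, he.2.2, he.2.1⟩⟩⟩
  loopless := ⟨fun _ h => h.1 rfl⟩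

/-- The four networks: the edges `13` and `24` are always present; none of, one of, or both of
the edges `12` and `34` are deleted. -/
def net (a12 a13 a24 a34 : ℝ) : Fin 4 → Fin 6 → ℝ :=
  ![weights a12 a13 a24 a34, weights 0 a13 a24 a34,
    weights a12 a13 a24 0, weights 0 a13 a24 0]

/-- The measurements of `x` and `x'` agree asymptotically up to a constant phase shift: they become
indistinguishable with respect to `I - (1/2) 𝟙 𝟙ᵀ`, with every rate `μ` that bounds the coupling from
below; with respect to every positive definite matrix they become indistinguishable after a
constant phase shift; and they coincide if they coincide initially. -/
def EqualUpToPhaseShift (a13 a24 : ℝ) (x x' : ℝ → Fin 4 → ℝ) : Prop :=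
  BecomeIndistinguishable (centering 2)
    (fun t => obs.mulVec (x t)) (fun t => obs.mulVec (x' t)) ∧
  (∀ μ : ℝ, (∀ t, 0 ≤ t → μ ≤ coupling a13 a24 (x t) ∧ μ ≤ coupling a13 a24 (x' t)) →
    ∀ t, 0 ≤ t → weightedNorm (centering 2) (obs.mulVec (x t) - obs.mulVec (x' t)) ≤
      Real.exp (-μ * t) *
        weightedNorm (centering 2) (obs.mulVec (x 0) - obs.mulVec (x' 0))) ∧
  (∃ c : ℝ, ∀ N : Matrix (Fin 2) (Fin 2) ℝ, N.PosDef →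
    BecomeIndistinguishable N
      (fun t => obs.mulVec (x t)) (fun t => obs.mulVec (x' t) + fun _ => c)) ∧
  (obs.mulVec (x 0) = obs.mulVec (x' 0) →
    ∀ t, 0 ≤ t → obs.mulVec (x t) = obs.mulVec (x' t))

/-- The networks with weights `w` and `w'` cannot be told apart, up to a constant phase shift,
along `π/2`-phase cohesive trajectories that satisfy the symmetry condition. -/
def CohesiveIndistinguishable (ω : Fin 4 → ℝ) (a13 a24 : ℝ) (w w' : Fin 6 → ℝ) : Prop :=
  ∀ x x' : ℝ → Fin 4 → ℝ,
    IsTrajectory ω w x → IsTrajectory ω w' x' →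
    PhaseCohesive (Real.pi / 2) x → PhaseCohesive (Real.pi / 2) x' →
    (∀ t, 0 ≤ t → SymmetryCondition a13 a24 (x t)) →
    (∀ t, 0 ≤ t → SymmetryCondition a13 a24 (x' t)) →
    EqualUpToPhaseShift a13 a24 x x'

/-- The same, if instead of phase cohesiveness positivity of the coupling is known, and this
together with the symmetry condition along all solutions `X s`, `0 ≤ s ≤ 1`, of the auxiliary
system that connects the trajectories `X 0` and `X 1` of the two networks. -/
def AuxiliaryIndistinguishable (ω : Fin 4 → ℝ) (a13 a24 : ℝ) (w w' : Fin 6 → ℝ) : Prop :=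
  ∀ X : ℝ → ℝ → Fin 4 → ℝ,
    (∀ s ∈ Set.Icc (0 : ℝ) 1, IsTrajectory ω (w + s • (w' - w)) (X s) ∧
      X s 0 = (1 - s) • X 0 0 + s • X 1 0) →
    (∀ s ∈ Set.Icc (0 : ℝ) 1, ∀ t, 0 ≤ t →
      0 < coupling a13 a24 (X s t) ∧ SymmetryCondition a13 a24 (X s t)) →
    EqualUpToPhaseShift a13 a24 (X 0) (X 1)

end

end KuramotoFour

open KuramotoFour

namespace KuramotoFour

/-! ### The scalar dynamics -/

/-! The edges 12 and 34 lie inside the two measured groups, so their flows cancel in the sums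
forming the output. Only the flow `crossFlow` through the edges 13 and 24 remains: the sum of the
two outputs grows at the constant rate given by the total frequency, and their difference z
satisfies z' = const - 2h with h = a₁₃ sin α + a₂₄ sin β, α = x₁ - x₃, β = x₂ - x₄, z = α + β. In
general h is not a function of z, but the symmetry condition makes r = a₁₃ cos α = a₂₄ cos β the
height of a triangle with sides a₁₃, a₂₄ and enclosed angle z, whose (signed) third side is h. Hence
h² is given by the law of cosines, h has the sign of z, and on either side of z = 0 one has dh/dz =
r = κ/2.

Two estimates follow. If m ≤ r and m ≤ r', then (h - h')(z - z') ≥ m (z - z')²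
(`TriangleData.contraction`), which gives the exponential rate μ = 2m. If |z - z'| ≥ η, the same
product is bounded below by a positive constant (`TriangleData.exists_separation`), which gives
convergence even if κ has no positive lower bound. They compare two triangles directly, so the
symmetry condition is needed only on the two trajectories, not on a path of states joining them.

Under (b) the phase differences need not lie in (-π/2, π/2). Nonvanishing cosines and the connecting
segment of initial states keep both trajectories on the same branch of the cosine; shifting by a
multiple of π and absorbing the sign into the weights restores the triangle
(`commonTriangle_of_branches`). The Jacobian claims are a separate matrix computation. -/

/-- The relations between `z = α + β`, `h = a sin α + b sin β` and `r = a cos α = b cos β`, if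
`a`, `b`, `r` are positive and `α`, `β` lie in `(-π/2, π/2)`: in a triangle with sides `a`, `b` and
enclosed angle `z`, the third side is `h`, and the height over it is `r`. -/
structure TriangleData (a b z h r : ℝ) : Prop where
  neg_pi_lt : -Real.pi < z
  lt_pi : z < Real.pi
  height_pos : 0 < r
  area : h * r = a * b * Real.sin z
  cosine_law : h ^ 2 = a ^ 2 + b ^ 2 - 2 * a * b * Real.cos z

theorem triangleData_of_angles {a b α β : ℝ} (ha : 0 < a)
    (hα : α ∈ Set.Ioo (-(Real.pi / 2)) (Real.pi / 2))
    (hβ : β ∈ Set.Ioo (-(Real.pi / 2)) (Real.pi / 2))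
    (h : a * Real.cos α = b * Real.cos β) :
    TriangleData a b (α + β) (a * Real.sin α + b * Real.sin β) (a * Real.cos α) where
  neg_pi_lt := by linarith [hα.1, hβ.1]
  lt_pi := by linarith [hα.2, hβ.2]
  height_pos := mul_pos ha (Real.cos_pos_of_mem_Ioo hα)
  area := by
    rw [Real.sin_add]
    linear_combination a * Real.sin α * h
  cosine_law := by
    rw [Real.cos_add]
    linear_combination a ^ 2 * Real.sin_sq_add_cos_sq α + b ^ 2 * Real.sin_sq_add_cos_sq β
      - (a * Real.cos α - b * Real.cos β) * h

namespace TriangleData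

variable {a b z h r z' h' r' : ℝ}

/-- Reflection, used to reduce negative angles to positive ones. -/
theorem neg (H : TriangleData a b z h r) : TriangleData a b (-z) (-h) r where
  neg_pi_lt := by linarith [H.lt_pi]
  lt_pi := by linarith [H.neg_pi_lt]
  height_pos := H.height_pos
  area := by rw [Real.sin_neg]; linear_combination -H.area
  cosine_law := by rw [Real.cos_neg]; linear_combination H.cosine_law

theorem side_pos (H : TriangleData a b z h r) (ha : 0 < a) (hb : 0 < b) (hz : 0 < z) : 0 < h := by
  have h1 : 0 < h * r := by
    rw [H.area]
    exact mul_pos (mul_pos ha hb) (Real.sin_pos_of_pos_of_lt_pi hz H.lt_pi)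
  exact pos_of_mul_pos_left h1 H.height_pos.le

theorem side_eq_zero (H : TriangleData a b z h r) (hz : z = 0) : h = 0 := by
  have h1 := H.area
  rw [hz, Real.sin_zero, mul_zero] at h1
  exact (mul_eq_zero.1 h1).resolve_right H.height_pos.ne'

/-- After multiplication by h, the area formula turns the claim into ab z sin z ≤ h². This follows
from z sin z ≤ 2(1 - cos z), a form of z/2 ≤ tan(z/2), and from (a - b)² ≥ 0. It serves as a
comparison with the angle 0, where h jumps if a ≠ b. -/
theorem height_mul_angle_le (H : TriangleData a b z h r) (ha : 0 < a) (hb : 0 < b)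
    (hz : 0 ≤ z) : r * z ≤ h := by
  rcases hz.eq_or_lt with hz | hz
  · rw [H.side_eq_zero hz.symm, ← hz, mul_zero]
  have hh := H.side_pos ha hb hz
  have hab := mul_pos ha hb
  have hs : 0 < Real.sin (z / 2) := Real.sin_pos_of_pos_of_lt_pi (by linarith)
    (by linarith [H.lt_pi, Real.pi_pos])
  have hc : 0 < Real.cos (z / 2) := Real.cos_pos_of_mem_Ioo
    ⟨by linarith [Real.pi_pos], by linarith [H.lt_pi]⟩
  have ht : z / 2 < Real.tan (z / 2) := Real.lt_tan (by linarith) (by linarith [H.lt_pi])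
  rw [Real.tan_eq_sin_div_cos, lt_div_iff₀ hc] at ht
  have h2 : Real.sin z = 2 * Real.sin (z / 2) * Real.cos (z / 2) := by
    rw [← Real.sin_two_mul]; ring_nf
  have h3 : Real.cos z = 1 - 2 * Real.sin (z / 2) ^ 2 := by
    have := Real.cos_sq' (z / 2)
    have h4 := Real.cos_two_mul (z / 2)
    rw [mul_div_cancel₀ z two_ne_zero] at h4
    linarith
  have h5 : h * (r * z) ≤ h * h := by
    have h6 : z * Real.sin z ≤ 2 - 2 * Real.cos z := by
      rw [h2, h3]; nlinarith
    nlinarith [H.area, H.cosine_law, sq_nonneg (a - b), mul_le_mul_of_nonneg_left h6 hab.le]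
  exact le_of_mul_le_mul_left h5 hh

/-- The third side √(Q u) has slope ab sin u / √(Q u), the height at angle u. A bound m on the
heights at both ends persists in between, so √Q - m u is monotone. -/
theorem contraction_of_pos (H : TriangleData a b z h r) (H' : TriangleData a b z' h' r')
    (ha : 0 < a) (hb : 0 < b) (hz' : 0 < z') (hz : z' ≤ z) {m : ℝ} (hm0 : 0 ≤ m)
    (hm : m ≤ r) (hm' : m ≤ r') : m * (z - z') ≤ h - h' := by
  have hab := mul_pos ha hb
  have hh := H.side_pos ha hb (hz'.trans_le hz)
  have hh' := H'.side_pos ha hb hz'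
  set Q : ℝ → ℝ := fun u => a ^ 2 + b ^ 2 - 2 * a * b * Real.cos u with hQ
  have hcos : ∀ u ∈ Set.Icc z' z, Real.cos z ≤ Real.cos u ∧ Real.cos u ≤ Real.cos z' :=
    fun u hu => ⟨Real.cos_le_cos_of_nonneg_of_le_pi (by linarith [hu.1]) H.lt_pi.le hu.2,
      Real.cos_le_cos_of_nonneg_of_le_pi hz'.le (by linarith [hu.2, H.lt_pi]) hu.1⟩
  have hQpos : ∀ u ∈ Set.Icc z' z, 0 < Q u := fun u hu => by
    have h1 := (hcos u hu).2
    have : 0 < h' ^ 2 := by positivity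
    rw [H'.cosine_law] at this
    simp only [hQ]
    nlinarith
  have hder : ∀ u ∈ Set.Icc z' z, HasDerivAt (fun u => Real.sqrt (Q u) - m * u)
      (2 * a * b * Real.sin u / (2 * Real.sqrt (Q u)) - m) u := fun u hu => by
    have h1 : HasDerivAt Q (2 * a * b * Real.sin u) u := by
      have := ((Real.hasDerivAt_cos u).const_mul (2 * a * b)).const_sub (a ^ 2 + b ^ 2)
      exact this.congr_deriv (by ring)
    exact ((h1.sqrt (hQpos u hu).ne').sub ((hasDerivAt_id u).const_mul m)).congr_deriv (by simp)
  have hmono : MonotoneOn (fun u => Real.sqrt (Q u) - m * u) (Set.Icc z' z) := by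
    refine monotoneOn_of_hasDerivWithinAt_nonneg (convex_Icc _ _)
      (fun u hu => (hder u hu).continuousAt.continuousWithinAt)
      (fun u hu => (hder u (interior_subset hu)).hasDerivWithinAt) fun u hu => ?_
    replace hu := interior_subset hu
    have hq := Real.sqrt_pos.2 (hQpos u hu)
    have hs : 0 ≤ Real.sin u := Real.sin_nonneg_of_nonneg_of_le_pi (by linarith [hu.1])
      (by linarith [hu.2, H.lt_pi])
    rw [sub_nonneg, le_div_iff₀ (by positivity)]
    -- In terms of cos u, the left side is affine and the right side concave, so the inequality
    -- passes from the two endpoints to the interval.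
    have key : (m * Real.sqrt (Q u)) ^ 2 ≤ (a * b * Real.sin u) ^ 2 := by
      rw [mul_pow, Real.sq_sqrt (hQpos u hu).le, mul_pow, Real.sin_sq]
      have e1 : m ^ 2 * h ^ 2 ≤ (a * b) ^ 2 * (1 - Real.cos z ^ 2) := by
        rw [← Real.sin_sq, ← mul_pow, ← mul_pow, ← H.area, mul_comm h r]
        gcongr
      have e2 : m ^ 2 * h' ^ 2 ≤ (a * b) ^ 2 * (1 - Real.cos z' ^ 2) := by
        rw [← Real.sin_sq, ← mul_pow, ← mul_pow, ← H'.area, mul_comm h' r']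
        gcongr
      rw [H.cosine_law] at e1
      rw [H'.cosine_law] at e2
      obtain ⟨c1, c2⟩ := hcos u hu
      simp only [hQ]
      generalize Real.cos u = c at *
      generalize Real.cos z = c₀ at *
      generalize Real.cos z' = c₁ at *
      rcases (c1.trans c2).eq_or_lt with e | e
      · have : c = c₀ := le_antisymm (e ▸ c2) c1
        rw [this]; exact e1
      · have f1 := mul_le_mul_of_nonneg_left e1 (sub_nonneg.2 c2)
        have f2 := mul_le_mul_of_nonneg_left e2 (sub_nonneg.2 c1)
        -- The amount by which the concave side exceeds its chord, scaled by the length of the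
        -- interval.
        have f3 : 0 ≤ (a * b) ^ 2 * ((c - c₀) * (c₁ - c) * (c₁ - c₀)) :=
          mul_nonneg (sq_nonneg _) (mul_nonneg (mul_nonneg (sub_nonneg.2 c1) (sub_nonneg.2 c2))
            (sub_nonneg.2 e.le))
        refine le_of_mul_le_mul_left ?_ (sub_pos.2 e)
        linarith
    linarith [abs_le_of_sq_le_sq' key (by positivity) |>.2]
  have := hmono (Set.left_mem_Icc.2 hz) (Set.right_mem_Icc.2 hz) hz
  simp only [hQ, ← H.cosine_law, ← H'.cosine_law, Real.sqrt_sq hh.le, Real.sqrt_sq hh'.le] at this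
  linarith

theorem contraction_of_le (H : TriangleData a b z h r) (H' : TriangleData a b z' h' r')
    (ha : 0 < a) (hb : 0 < b) (hz : z' ≤ z) {m : ℝ} (hm0 : 0 ≤ m)
    (hm : m ≤ r) (hm' : m ≤ r') : m * (z - z') ≤ h - h' := by
  rcases lt_or_ge 0 z' with h1 | h1
  · exact H.contraction_of_pos H' ha hb h1 hz hm0 hm hm'
  rcases lt_or_ge z 0 with h2 | h2
  · have := H'.neg.contraction_of_pos H.neg ha hb (by linarith) (by linarith) hm0 hm' hm
    linarith
  -- Angles on opposite sides of 0: each is compared with 0, and the two bounds are added.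
  · have e1 := H.height_mul_angle_le ha hb h2
    have e2 := H'.neg.height_mul_angle_le ha hb (by linarith)
    nlinarith

theorem contraction (H : TriangleData a b z h r) (H' : TriangleData a b z' h' r')
    (ha : 0 < a) (hb : 0 < b) {m : ℝ} (hm : m ≤ r) (hm' : m ≤ r') :
    m * (z - z') ^ 2 ≤ (h - h') * (z - z') := by
  -- Heights are positive, so m may be replaced by its positive part.
  have h0 : m * (z - z') ^ 2 ≤ max m 0 * (z - z') ^ 2 := by
    gcongr; exact le_max_left _ _
  refine h0.trans ?_
  have k1 := max_le hm H.height_pos.le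
  have k2 := max_le hm' H'.height_pos.le
  rcases le_total z' z with hz | hz
  · have := H.contraction_of_le H' ha hb hz (le_max_right m 0) k1 k2
    nlinarith
  · have := H'.contraction_of_le H ha hb hz (le_max_right m 0) k2 k1
    nlinarith

/-! ### Separation of the sides, uniform over all triangles -/

theorem side_le (H : TriangleData a b z h r) (ha : 0 < a) (hb : 0 < b) : h ≤ a + b := by
  refine (abs_le_of_sq_le_sq' ?_ (by positivity)).2
  rw [H.cosine_law]
  nlinarith [Real.neg_one_le_cos z, mul_pos ha hb]

theorem side_ge (H : TriangleData a b z h r) (ha : 0 < a) (hb : 0 < b) {η : ℝ} (hη : 0 < η)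
    (hz : η ≤ z) : 2 * a * b * (1 - Real.cos η) / (a + b) ≤ h := by
  have hh := H.side_pos ha hb (by linarith)
  have hcos := Real.cos_le_cos_of_nonneg_of_le_pi hη.le H.lt_pi.le hz
  rw [div_le_iff₀ (by positivity)]
  calc 2 * a * b * (1 - Real.cos η) ≤ 2 * a * b * (1 - Real.cos z) := by gcongr
    _ ≤ h ^ 2 := by rw [H.cosine_law]; nlinarith [sq_nonneg (a - b)]
    _ ≤ h * (a + b) := by rw [sq]; gcongr; exact H.side_le ha hb

/-- By the law of cosines, (h - h')(h + h') = 4ab sin((z + z')/2) sin((z - z')/2). Both sines are at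
least sin(η/2), and h + h' ≤ 2(a + b). -/
theorem separation_of_nonneg (H : TriangleData a b z h r) (H' : TriangleData a b z' h' r')
    (ha : 0 < a) (hb : 0 < b) (hz' : 0 ≤ z') {η : ℝ} (hη : 0 < η) (hz : η ≤ z - z') :
    2 * a * b * Real.sin (η / 2) ^ 2 / (a + b) ≤ h - h' := by
  have hh := H.side_pos ha hb (by linarith)
  have hh' : 0 ≤ h' := by
    rcases hz'.eq_or_lt with e | e
    · exact (H'.side_eq_zero e.symm).ge
    · exact (H'.side_pos ha hb e).le
  have hpi := H.lt_pi
  have hs : 0 ≤ Real.sin (η / 2) := Real.sin_nonneg_of_nonneg_of_le_pi (by linarith) (by linarith)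
  have s1 : Real.sin (η / 2) ≤ Real.sin ((z - z') / 2) :=
    Real.sin_le_sin_of_le_of_le_pi_div_two (by linarith) (by linarith) (by linarith)
  have s2 : Real.sin (η / 2) ≤ Real.sin ((z + z') / 2) := by
    rcases le_total ((z + z') / 2) (Real.pi / 2) with e | e
    · exact Real.sin_le_sin_of_le_of_le_pi_div_two (by linarith) e (by linarith)
    -- From z < π and z' ≤ z - η, the reflected angle π - (z + z')/2 is still at least η/2.
    · rw [← Real.sin_pi_sub ((z + z') / 2)]
      exact Real.sin_le_sin_of_le_of_le_pi_div_two (by linarith) (by linarith) (by linarith)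
  have s3 : Real.cos z' - Real.cos z = 2 * Real.sin ((z + z') / 2) * Real.sin ((z - z') / 2) := by
    rw [← neg_sub, Real.cos_sub_cos]; ring
  have s4 : Real.sin (η / 2) ^ 2 ≤ Real.sin ((z + z') / 2) * Real.sin ((z - z') / 2) := by
    rw [sq]; gcongr; exact hs.trans s2
  have s5 : (h - h') * (h + h') = 4 * a * b *
      (Real.sin ((z + z') / 2) * Real.sin ((z - z') / 2)) := by
    linear_combination H.cosine_law - H'.cosine_law + 2 * a * b * s3
  have s6 : 4 * a * b * Real.sin (η / 2) ^ 2 ≤ (h - h') * (h + h') := by rw [s5]; gcongr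
  have s7 : 0 ≤ h - h' := by
    by_contra! hneg
    have : 0 ≤ 4 * a * b * Real.sin (η / 2) ^ 2 := by positivity
    nlinarith
  rw [div_le_iff₀ (by positivity)]
  nlinarith [H.side_le ha hb, H'.side_le ha hb]

/-- Triangles whose angles differ by at least `η` have sides that differ by a definite amount. -/
theorem exists_separation (ha : 0 < a) (hb : 0 < b) {η : ℝ} (hη : 0 < η) (hπ : η < Real.pi) :
    ∃ k > 0, ∀ z h r z' h' r' : ℝ, TriangleData a b z h r → TriangleData a b z' h' r' →
      η ≤ |z - z'| → k ≤ (h - h') * (z - z') := by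
  set k₁ := 2 * a * b * Real.sin (η / 2) ^ 2 / (a + b)
  set k₂ := 2 * a * b * (1 - Real.cos (η / 2)) / (a + b)
  have hk₁ : 0 < k₁ := by
    have := Real.sin_pos_of_pos_of_lt_pi (x := η / 2) (by linarith) (by linarith)
    positivity
  have hk₂ : 0 < k₂ := by
    have : 0 < 1 - Real.cos (η / 2) := by
      have := Real.cos_lt_cos_of_nonneg_of_le_pi (x := 0) (y := η / 2) le_rfl (by linarith)
        (by linarith)
      rw [Real.cos_zero] at this
      linarith
    positivity
  have main : ∀ z h r z' h' r' : ℝ, TriangleData a b z h r → TriangleData a b z' h' r' →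
      η ≤ z - z' → min k₁ k₂ ≤ h - h' := fun z h r z' h' r' H H' hz => by
    rcases le_or_gt 0 z' with h1 | h1
    · exact (min_le_left _ _).trans (H.separation_of_nonneg H' ha hb h1 hη hz)
    rcases le_or_gt z 0 with h2 | h2
    · have := H'.neg.separation_of_nonneg H.neg ha hb (by linarith) hη (by linarith)
      exact (min_le_left _ _).trans (by linarith)
    refine (min_le_right _ _).trans ?_
    have p1 := H.side_pos ha hb h2
    have p2 := H'.neg.side_pos ha hb (by linarith)
    -- Here z' < 0 < z, so one of z and -z' is at least η/2, and its side alone gives the bound.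
    rcases le_total (η / 2) z with h3 | h3
    · linarith [H.side_ge ha hb (by linarith) h3]
    · linarith [H'.neg.side_ge ha hb (η := η / 2) (by linarith) (by linarith)]
  have hk := lt_min hk₁ hk₂
  refine ⟨min k₁ k₂ * η, by positivity, fun z h r z' h' r' H H' hz => ?_⟩
  rcases le_abs.1 hz with hz | hz
  · have := main _ _ _ _ _ _ H H' hz
    gcongr
    exact hk.le.trans this
  · have := main _ _ _ _ _ _ H' H (by linarith)
    calc min k₁ k₂ * η ≤ (h' - h) * (z' - z) := by
          gcongr
          · exact hk.le.trans this
          · linarith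
      _ = _ := by ring

end TriangleData

/-! ### Output differences along trajectories -/

/-- The weights `w` have `w₁₃ = a`, `w₂₄ = b` and `w₁₄ = w₂₃ = 0`. -/
structure CrossWeights (a b : ℝ) (w : Fin 6 → ℝ) : Prop where
  w13 : w 1 = a
  w14 : w 2 = 0
  w23 : w 3 = 0
  w24 : w 4 = b

/-- The difference of the two measurements. -/
def outputDiff (x : Fin 4 → ℝ) : ℝ := (x 0 - x 2) + (x 1 - x 3)

/-- The flow between the two measured groups. -/
noncomputable def crossFlow (a b : ℝ) (x : Fin 4 → ℝ) : ℝ :=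
  a * Real.sin (x 0 - x 2) + b * Real.sin (x 1 - x 3)

theorem incidence_transpose_mulVec (x : Fin 4 → ℝ) :
    incidence.transpose.mulVec x =
      ![x 0 - x 1, x 0 - x 2, x 0 - x 3, x 1 - x 2, x 1 - x 3, x 2 - x 3] := by
  ext e
  fin_cases e <;> simp [incidence, Matrix.mulVec, dotProduct, Fin.sum_univ_four] <;> ring

theorem obs_mulVec (x : Fin 4 → ℝ) : obs.mulVec x = ![x 0 + x 1, x 2 + x 3] := by
  ext e
  fin_cases e <;> simp [obs, Matrix.mulVec, dotProduct, Fin.sum_univ_four]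

theorem incidence_mulVec (v : Fin 6 → ℝ) : incidence.mulVec v =
    ![v 0 + v 1 + v 2, -v 0 + v 3 + v 4, -v 1 - v 3 + v 5, -v 2 - v 4 - v 5] := by
  ext e
  fin_cases e <;> simp [incidence, Matrix.mulVec, dotProduct, Fin.sum_univ_six] <;> ring

theorem field_apply (ω : Fin 4 → ℝ) (w : Fin 6 → ℝ) (x : Fin 4 → ℝ) :
    field ω w x = ![
      ω 0 - (w 0 * Real.sin (x 0 - x 1) + w 1 * Real.sin (x 0 - x 2) + w 2 * Real.sin (x 0 - x 3)),
      ω 1 - (-(w 0 * Real.sin (x 0 - x 1)) + w 3 * Real.sin (x 1 - x 2)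
        + w 4 * Real.sin (x 1 - x 3)),
      ω 2 - (-(w 1 * Real.sin (x 0 - x 2)) - w 3 * Real.sin (x 1 - x 2)
        + w 5 * Real.sin (x 2 - x 3)),
      ω 3 - (-(w 2 * Real.sin (x 0 - x 3)) - w 4 * Real.sin (x 1 - x 3)
        - w 5 * Real.sin (x 2 - x 3))] := by
  rw [field, incidence_transpose_mulVec, incidence_mulVec]
  ext e
  fin_cases e <;> simp [Matrix.mulVec_diagonal]

theorem obs_mulVec_field (ω : Fin 4 → ℝ) {a b : ℝ} {w : Fin 6 → ℝ} (hw : CrossWeights a b w)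
    (x : Fin 4 → ℝ) : obs.mulVec (field ω w x) =
      ![ω 0 + ω 1 - crossFlow a b x, ω 2 + ω 3 + crossFlow a b x] := by
  rw [obs_mulVec, field_apply]
  ext e
  fin_cases e <;> simp [crossFlow, hw.w13, hw.w14, hw.w23, hw.w24] <;> ring

theorem weightedNorm_centering (v : Fin 2 → ℝ) :
    weightedNorm (centering 2) v = |v 0 - v 1| / Real.sqrt 2 := by
  rw [weightedNorm, ← Real.sqrt_sq_eq_abs, ← Real.sqrt_div (sq_nonneg _)]
  congr 1
  simp [centering, Matrix.mulVec, dotProduct, Fin.sum_univ_two, Matrix.vecMulVec_apply]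
  ring

theorem weightedNorm_smul {p : ℕ} (N : Matrix (Fin p) (Fin p) ℝ) (c : ℝ) (v : Fin p → ℝ) :
    weightedNorm N (c • v) = |c| * weightedNorm N v := by
  rw [weightedNorm, weightedNorm, ← Real.sqrt_sq_eq_abs, ← Real.sqrt_mul (sq_nonneg _)]
  congr 1
  rw [Matrix.mulVec_smul, dotProduct_smul, smul_dotProduct, smul_eq_mul, smul_eq_mul]
  ring

section
variable {ω : Fin 4 → ℝ} {a b : ℝ} {w w' : Fin 6 → ℝ} {x x' : ℝ → Fin 4 → ℝ}

theorem IsTrajectory.apply (hx : IsTrajectory ω w x) {t : ℝ} (ht : 0 ≤ t) (i : Fin 4) :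
    HasDerivWithinAt (fun t => x t i) (field ω w (x t) i) (Set.Ici 0) t :=
  hasDerivWithinAt_pi.1 (hx t ht) i

theorem IsTrajectory.outputDiff (hx : IsTrajectory ω w x) (hw : CrossWeights a b w) {t : ℝ}
    (ht : 0 ≤ t) : HasDerivWithinAt (fun t => outputDiff (x t))
      (ω 0 + ω 1 - ω 2 - ω 3 - 2 * crossFlow a b (x t)) (Set.Ici 0) t := by
  refine (((hx.apply ht 0).sub (hx.apply ht 2)).add
    ((hx.apply ht 1).sub (hx.apply ht 3))).congr_deriv ?_
  have h0 := congrFun (obs_mulVec_field ω hw (x t)) 0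
  have h1 := congrFun (obs_mulVec_field ω hw (x t)) 1
  rw [obs_mulVec] at h0 h1
  simp only [Matrix.cons_val_zero, Matrix.cons_val_one] at h0 h1
  linear_combination h0 - h1

theorem IsTrajectory.sum (hx : IsTrajectory ω w x) (hw : CrossWeights a b w) {t : ℝ}
    (ht : 0 ≤ t) : HasDerivWithinAt (fun t => x t 0 + x t 1 + (x t 2 + x t 3))
      (ω 0 + ω 1 + (ω 2 + ω 3)) (Set.Ici 0) t := by
  refine (((hx.apply ht 0).add (hx.apply ht 1)).add
    ((hx.apply ht 2).add (hx.apply ht 3))).congr_deriv ?_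
  have h0 := congrFun (obs_mulVec_field ω hw (x t)) 0
  have h1 := congrFun (obs_mulVec_field ω hw (x t)) 1
  rw [obs_mulVec] at h0 h1
  simp only [Matrix.cons_val_zero, Matrix.cons_val_one] at h0 h1
  linear_combination h0 + h1

theorem antitoneOn_Ici_of_hasDerivWithinAt {f f' : ℝ → ℝ}
    (hf : ∀ t, 0 ≤ t → HasDerivWithinAt f (f' t) (Set.Ici 0) t) (hf' : ∀ t, 0 ≤ t → f' t ≤ 0) :
    AntitoneOn f (Set.Ici 0) :=
  antitoneOn_of_hasDerivWithinAt_nonpos (convex_Ici 0)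
    (fun t ht => (hf t ht).continuousWithinAt)
    (fun t ht => (hf t (interior_subset ht)).mono interior_subset)
    fun t ht => hf' t (interior_subset ht)

/-- All flows cancel in the sum of the phases, so both sums grow at the same constant rate. This
conserved difference determines the constant phase shift. -/
theorem sum_sub_sum_eq (hx : IsTrajectory ω w x) (hx' : IsTrajectory ω w' x')
    (hw : CrossWeights a b w) (hw' : CrossWeights a b w') {t : ℝ} (ht : 0 ≤ t) :
    (x t 0 + x t 1 + (x t 2 + x t 3)) - (x' t 0 + x' t 1 + (x' t 2 + x' t 3)) =
      (x 0 0 + x 0 1 + (x 0 2 + x 0 3)) - (x' 0 0 + x' 0 1 + (x' 0 2 + x' 0 3)) := by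
  refine le_antisymm ?_ ?_
  · exact antitoneOn_Ici_of_hasDerivWithinAt
      (fun t ht => (hx.sum hw ht).sub (hx'.sum hw' ht)) (fun _ _ => (sub_self _).le)
      (Set.self_mem_Ici) ht ht
  · have := antitoneOn_Ici_of_hasDerivWithinAt
      (fun t ht => (hx'.sum hw' ht).sub (hx.sum hw ht)) (fun _ _ => (sub_self _).le)
      (Set.self_mem_Ici) ht ht
    simp only [Pi.sub_apply] at this
    linarith

theorem hasDerivWithinAt_outputDiff_sub_sq (hx : IsTrajectory ω w x) (hx' : IsTrajectory ω w' x')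
    (hw : CrossWeights a b w) (hw' : CrossWeights a b w') {t : ℝ} (ht : 0 ≤ t) :
    HasDerivWithinAt (fun t => (outputDiff (x t) - outputDiff (x' t)) ^ 2)
      (-4 * ((crossFlow a b (x t) - crossFlow a b (x' t)) *
        (outputDiff (x t) - outputDiff (x' t)))) (Set.Ici 0) t := by
  refine (((hx.outputDiff hw ht).sub (hx'.outputDiff hw' ht)).pow 2).congr_deriv ?_
  simp only [Pi.sub_apply]
  push_cast
  ring

/-- The hypothesis makes exp(2μt) times the squared difference nonincreasing. The factor μ/2 appears
because the height is half the coupling. -/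
theorem abs_outputDiff_sub_le {μ : ℝ} (hx : IsTrajectory ω w x) (hx' : IsTrajectory ω w' x')
    (hw : CrossWeights a b w) (hw' : CrossWeights a b w')
    (hμ : ∀ t, 0 ≤ t → μ / 2 * (outputDiff (x t) - outputDiff (x' t)) ^ 2 ≤
      (crossFlow a b (x t) - crossFlow a b (x' t)) * (outputDiff (x t) - outputDiff (x' t)))
    {t : ℝ} (ht : 0 ≤ t) : |outputDiff (x t) - outputDiff (x' t)| ≤
      Real.exp (-μ * t) * |outputDiff (x 0) - outputDiff (x' 0)| := by
  have hd : ∀ t, 0 ≤ t → HasDerivWithinAt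
      (fun t => Real.exp (2 * μ * t) * (outputDiff (x t) - outputDiff (x' t)) ^ 2)
      (Real.exp (2 * μ * t) * (2 * μ * (outputDiff (x t) - outputDiff (x' t)) ^ 2 +
        -4 * ((crossFlow a b (x t) - crossFlow a b (x' t)) *
        (outputDiff (x t) - outputDiff (x' t))))) (Set.Ici 0) t := fun t ht => by
    refine ((((hasDerivAt_id t).const_mul (2 * μ)).exp.hasDerivWithinAt).mul
      (hasDerivWithinAt_outputDiff_sub_sq hx hx' hw hw' ht)).congr_deriv ?_
    simp only [id, mul_one]
    ring
  have h1 := antitoneOn_Ici_of_hasDerivWithinAt hd (fun t ht =>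
    mul_nonpos_of_nonneg_of_nonpos (Real.exp_pos _).le (by linarith [hμ t ht]))
    (Set.self_mem_Ici) ht ht
  simp only [mul_zero, Real.exp_zero, one_mul] at h1
  refine abs_le_of_sq_le_sq (a := |_|) ?_ (by positivity) |> (le_abs_self _).trans
  rw [mul_pow, sq_abs, sq_abs, ← Real.exp_nat_mul]
  have h2 := mul_le_mul_of_nonneg_left h1 (Real.exp_pos (-(2 * μ * t))).le
  rw [← mul_assoc, ← Real.exp_add, neg_add_cancel, Real.exp_zero, one_mul] at h2
  convert h2 using 3
  push_cast
  ring

/-- Along both trajectories, up to a common shift of the output difference, the flow and the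
coupling between the two measured groups are the side and the height of a triangle. -/
def CommonTriangle (a b : ℝ) (x x' : ℝ → Fin 4 → ℝ) : Prop :=
  ∃ A B c : ℝ, 0 < A ∧ 0 < B ∧ ∀ t, 0 ≤ t →
    TriangleData A B (outputDiff (x t) - c) (crossFlow a b (x t)) (coupling a b (x t) / 2) ∧
    TriangleData A B (outputDiff (x' t) - c) (crossFlow a b (x' t)) (coupling a b (x' t) / 2)

theorem CommonTriangle.contraction (hT : CommonTriangle a b x x') {μ t : ℝ} (ht : 0 ≤ t)
    (h : μ ≤ coupling a b (x t)) (h' : μ ≤ coupling a b (x' t)) :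
    μ / 2 * (outputDiff (x t) - outputDiff (x' t)) ^ 2 ≤
      (crossFlow a b (x t) - crossFlow a b (x' t)) *
        (outputDiff (x t) - outputDiff (x' t)) := by
  obtain ⟨A, B, c, hA, hB, H⟩ := hT
  have := (H t ht).1.contraction (H t ht).2 hA hB (m := μ / 2) (by linarith) (by linarith)
  simpa using this

theorem CommonTriangle.dissipation (hT : CommonTriangle a b x x') {t : ℝ} (ht : 0 ≤ t) :
    0 ≤ (crossFlow a b (x t) - crossFlow a b (x' t)) *
        (outputDiff (x t) - outputDiff (x' t)) := by
  have hT' := hT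
  obtain ⟨A, B, c, hA, hB, H⟩ := hT'
  have := hT.contraction (μ := 0) ht (by linarith [(H t ht).1.height_pos])
    (by linarith [(H t ht).2.height_pos])
  simpa using this

/-- The coupling may tend to 0, so no exponential rate is available. The difference is nonincreasing
in absolute value; if it stayed above ε, uniform separation would make its square decrease at least
linearly, hence become negative. -/
theorem exists_abs_outputDiff_sub_lt (hx : IsTrajectory ω w x) (hx' : IsTrajectory ω w' x')
    (hw : CrossWeights a b w) (hw' : CrossWeights a b w') (hT : CommonTriangle a b x x')
    {ε : ℝ} (hε : 0 < ε) :
    ∃ T > 0, ∀ t > T, |outputDiff (x t) - outputDiff (x' t)| < ε := by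
  have hanti : ∀ s t, 0 ≤ s → s ≤ t → |outputDiff (x t) - outputDiff (x' t)| ≤
      |outputDiff (x s) - outputDiff (x' s)| := fun s t hs hst =>
    sq_le_sq.1 (antitoneOn_Ici_of_hasDerivWithinAt
      (fun t ht => hasDerivWithinAt_outputDiff_sub_sq hx hx' hw hw' ht)
      (fun t ht => by linarith [hT.dissipation ht]) (Set.mem_Ici.2 hs)
      (Set.mem_Ici.2 (hs.trans hst)) hst)
  suffices ∃ T > 0, |outputDiff (x T) - outputDiff (x' T)| < ε by
    obtain ⟨T, hT0, h⟩ := this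
    exact ⟨T, hT0, fun t ht => (hanti T t hT0.le ht.le).trans_lt h⟩
  by_contra! hne
  obtain ⟨A, B, c, hA, hB, H⟩ := hT
  obtain ⟨k, hk, hsep⟩ := TriangleData.exists_separation hA hB (η := min ε 1)
    (lt_min hε one_pos) ((min_le_right _ _).trans_lt (by linarith [Real.pi_gt_three]))
  have hk' : ∀ t, 0 ≤ t → k ≤ (crossFlow a b (x t) - crossFlow a b (x' t)) *
        (outputDiff (x t) - outputDiff (x' t)) := fun t ht => by
    have h1 : ε ≤ |outputDiff (x t) - outputDiff (x' t)| :=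
      -- The negated claim covers only positive times; monotonicity carries the bound from t + 1
      -- back to t, including t = 0.
      (hne (t + 1) (by linarith)).trans (hanti t (t + 1) ht (by linarith))
    have := hsep _ _ _ _ _ _ (H t ht).1 (H t ht).2
      (by rw [sub_sub_sub_cancel_right]; exact (min_le_left _ _).trans h1)
    rwa [sub_sub_sub_cancel_right] at this
  set D₀ := (outputDiff (x 0) - outputDiff (x' 0)) ^ 2 with hD₀
  -- The square plus 4kt is nonincreasing, so at t = (D₀ + 1)/(4k) the square would be at most -1.
  have hlin := antitoneOn_Ici_of_hasDerivWithinAt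
    (fun t ht => (hasDerivWithinAt_outputDiff_sub_sq hx hx' hw hw' ht).add
      ((hasDerivAt_id t).const_mul (4 * k)).hasDerivWithinAt)
    (fun t ht => by linarith [hk' t ht]) (Set.self_mem_Ici)
    (Set.mem_Ici.2 (show 0 ≤ (D₀ + 1) / (4 * k) by positivity)) (by positivity)
  simp only [Pi.add_apply, id, mul_zero, add_zero] at hlin
  rw [mul_div_cancel₀ _ (by positivity)] at hlin
  nlinarith [sq_nonneg (outputDiff (x ((D₀ + 1) / (4 * k))) -
    outputDiff (x' ((D₀ + 1) / (4 * k))))]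

theorem equalUpToPhaseShift (hx : IsTrajectory ω w x) (hx' : IsTrajectory ω w' x')
    (hw : CrossWeights a b w) (hw' : CrossWeights a b w') (hT : CommonTriangle a b x x') :
    EqualUpToPhaseShift a b x x' := by
  have hnorm : ∀ t, weightedNorm (centering 2) (obs.mulVec (x t) - obs.mulVec (x' t)) =
      |outputDiff (x t) - outputDiff (x' t)| / Real.sqrt 2 := fun t => by
    rw [weightedNorm_centering, obs_mulVec, obs_mulVec]
    simp only [Pi.sub_apply, Matrix.cons_val_zero, Matrix.cons_val_one, outputDiff]
    ring_nf
  have hs2 : 0 < Real.sqrt 2 := by positivity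
  refine ⟨fun ε hε => ?_, fun μ hμ t ht => ?_, ?_, fun h0 t ht => ?_⟩
  · obtain ⟨T, hT0, h⟩ := exists_abs_outputDiff_sub_lt hx hx' hw hw' hT (mul_pos hε hs2)
    exact ⟨T, hT0, fun t ht => by rw [hnorm, div_lt_iff₀ hs2]; exact h t ht⟩
  · rw [hnorm, hnorm, ← mul_div_assoc]
    gcongr
    exact abs_outputDiff_sub_le hx hx' hw hw'
      (fun t ht => hT.contraction ht (hμ t ht).1 (hμ t ht).2) ht
  · set S := (x 0 0 + x 0 1 + (x 0 2 + x 0 3)) - (x' 0 0 + x' 0 1 + (x' 0 2 + x' 0 3)) with hS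
    -- Shifting both components by S/2 equalizes the sums; what remains is a multiple of (1, -1)
    -- that tends to 0.
    refine ⟨S / 2, fun N _ ε hε => ?_⟩
    set n := weightedNorm N ![1, -1] with hn
    have hn0 : 0 ≤ n := Real.sqrt_nonneg _
    obtain ⟨T, hT0, h⟩ := exists_abs_outputDiff_sub_lt hx hx' hw hw' hT
      (ε := ε / (n + 1)) (by positivity)
    refine ⟨T, hT0, fun t ht => ?_⟩
    have hsum := sum_sub_sum_eq hx hx' hw hw' (hT0.le.trans ht.le)
    have hv : obs.mulVec (x t) - (obs.mulVec (x' t) + fun _ => S / 2) =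
        ((outputDiff (x t) - outputDiff (x' t)) / 2) • ![1, -1] := by
      rw [obs_mulVec, obs_mulVec]
      ext i
      fin_cases i
      · simp [outputDiff]; linarith
      · simp only [Pi.sub_apply, Pi.add_apply, Pi.smul_apply, smul_eq_mul, outputDiff]
        simp
        linarith
    have h1 := h t ht
    rw [lt_div_iff₀ (by positivity)] at h1
    rw [hv, weightedNorm_smul, abs_div, abs_two, ← hn]
    nlinarith [abs_nonneg (outputDiff (x t) - outputDiff (x' t))]
  · rw [obs_mulVec, obs_mulVec] at h0
    have e0 := congrFun h0 0
    have e1 := congrFun h0 1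
    simp only [Matrix.cons_val_zero, Matrix.cons_val_one] at e0 e1
    have hsum := sum_sub_sum_eq hx hx' hw hw' ht
    have hd := abs_outputDiff_sub_le (μ := 0) hx hx' hw hw'
      (fun t ht => by simpa using hT.dissipation ht) ht
    have hd0 : outputDiff (x 0) - outputDiff (x' 0) = 0 := by
      simp only [outputDiff]; linarith
    rw [hd0, abs_zero, mul_zero] at hd
    have hd1 := abs_eq_zero.1 (le_antisymm hd (abs_nonneg _))
    simp only [outputDiff] at hd1
    rw [obs_mulVec, obs_mulVec]
    ext i
    fin_cases i <;> simp <;> linarith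

end

/-! ### Phase differences on a branch of the cosine -/

/-- Since cos α₀ and cos β₀ are ±1, shifting the angles by α₀, β₀ and multiplying the weights by
these signs changes neither the flow nor the coupling. Positive coupling at one instant fixes the
signs of the new weights for all times, because these depend only on the branch. -/
theorem commonTriangle_of_branches {a b α₀ β₀ : ℝ} {x x' : ℝ → Fin 4 → ℝ}
    (hα₀ : Real.sin α₀ = 0) (hβ₀ : Real.sin β₀ = 0)
    (hα : ∀ t, 0 ≤ t → |x t 0 - x t 2 - α₀| < Real.pi / 2 ∧ |x' t 0 - x' t 2 - α₀| < Real.pi / 2)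
    (hβ : ∀ t, 0 ≤ t → |x t 1 - x t 3 - β₀| < Real.pi / 2 ∧ |x' t 1 - x' t 3 - β₀| < Real.pi / 2)
    (hS : ∀ t, 0 ≤ t → SymmetryCondition a b (x t))
    (hS' : ∀ t, 0 ≤ t → SymmetryCondition a b (x' t))
    (hκ : 0 < coupling a b (x 0)) : CommonTriangle a b x x' := by
  have hcos : ∀ {θ₀ : ℝ}, Real.sin θ₀ = 0 → ∀ c θ,
      c * Real.cos θ₀ * Real.cos (θ - θ₀) = c * Real.cos θ ∧
      c * Real.cos θ₀ * Real.sin (θ - θ₀) = c * Real.sin θ := fun {θ₀} h c θ => by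
    have h1 := Real.sin_sq_add_cos_sq θ₀
    rw [Real.cos_sub, Real.sin_sub, h]
    rw [h] at h1
    constructor
    · linear_combination c * Real.cos θ * h1
    · linear_combination c * Real.sin θ * h1
  have hpos : ∀ {c θ θ₀ : ℝ}, Real.sin θ₀ = 0 → |θ - θ₀| < Real.pi / 2 → 0 < c * Real.cos θ →
      0 < c * Real.cos θ₀ := fun {c θ θ₀} h hθ hc => by
    rw [← (hcos h c θ).1] at hc
    exact pos_of_mul_pos_left hc (Real.cos_pos_of_mem_Ioo (abs_lt.1 hθ)).le
  have key : ∀ v : Fin 4 → ℝ, 0 < a * Real.cos α₀ → |v 0 - v 2 - α₀| < Real.pi / 2 →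
      |v 1 - v 3 - β₀| < Real.pi / 2 → SymmetryCondition a b v →
      TriangleData (a * Real.cos α₀) (b * Real.cos β₀) (outputDiff v - (α₀ + β₀))
        (crossFlow a b v) (coupling a b v / 2) := fun v hA h1 h2 hs => by
    have := triangleData_of_angles (b := b * Real.cos β₀) hA (abs_lt.1 h1) (abs_lt.1 h2)
      (by rw [(hcos hα₀ _ _).1, (hcos hβ₀ _ _).1]; exact hs)
    rw [(hcos hα₀ _ _).1, (hcos hα₀ _ _).2, (hcos hβ₀ _ _).2] at this
    rw [crossFlow]
    convert this using 1
    · simp only [outputDiff]; ring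
    · simp only [coupling, SymmetryCondition] at hs ⊢; linarith
  have hs0 := hS 0 le_rfl
  simp only [coupling, SymmetryCondition] at hs0 hκ
  have hA := hpos (c := a) hα₀ (hα 0 le_rfl).1 (by linarith)
  have hB := hpos (c := b) hβ₀ (hβ 0 le_rfl).1 (by linarith)
  exact ⟨_, _, α₀ + β₀, hA, hB, fun t ht =>
    ⟨key _ hA (hα t ht).1 (hβ t ht).1 (hS t ht), key _ hA (hα t ht).2 (hβ t ht).2 (hS' t ht)⟩⟩

/-- A preconnected set of reals is order connected, so it cannot pass the zeros kπ ± π/2 next to the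
multiple kπ nearest to one of its points. -/
theorem exists_branch {S : Set ℝ} (hS : IsPreconnected S) (hcos : ∀ θ ∈ S, Real.cos θ ≠ 0) :
    ∃ θ₀, Real.sin θ₀ = 0 ∧ ∀ θ ∈ S, |θ - θ₀| < Real.pi / 2 := by
  rcases S.eq_empty_or_nonempty with rfl | ⟨x, hx⟩
  · exact ⟨0, Real.sin_zero, by simp⟩
  have hpi := Real.pi_pos
  set k := round (x / Real.pi)
  have hk : |x - k * Real.pi| ≤ Real.pi / 2 := by
    have h1 := abs_sub_round (x / Real.pi)
    have : x - k * Real.pi = (x / Real.pi - k) * Real.pi := by field_simp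
    rw [this, abs_mul, abs_of_pos hpi]
    nlinarith
  have hne : ∀ θ ∈ S, θ ≠ k * Real.pi + Real.pi / 2 ∧ θ ≠ k * Real.pi - Real.pi / 2 := by
    refine fun θ hθ => ⟨?_, ?_⟩ <;> rintro rfl <;> refine hcos _ hθ (Real.cos_eq_zero_iff.2 ?_)
    · exact ⟨k, by ring⟩
    · exact ⟨k - 1, by push_cast; ring⟩
  have hord := hS.ordConnected
  rw [abs_le] at hk
  refine ⟨k * Real.pi, Real.sin_int_mul_pi k, fun θ hθ => abs_lt.2 ⟨?_, ?_⟩⟩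
  · by_contra! h
    exact (hne (k * Real.pi - Real.pi / 2) (hord.out hθ hx ⟨by linarith, by linarith⟩)).2 rfl
  · by_contra! h
    exact (hne (k * Real.pi + Real.pi / 2) (hord.out hx hθ ⟨by linarith, by linarith⟩)).1 rfl

theorem exists_common_branch {f g : ℝ → ℝ} (hf : ContinuousOn f (Set.Ici 0))
    (hg : ContinuousOn g (Set.Ici 0)) (hf0 : ∀ t, 0 ≤ t → Real.cos (f t) ≠ 0)
    (hg0 : ∀ t, 0 ≤ t → Real.cos (g t) ≠ 0)
    (hs : ∀ s ∈ Set.Icc (0 : ℝ) 1, Real.cos ((1 - s) * f 0 + s * g 0) ≠ 0) :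
    ∃ θ₀, Real.sin θ₀ = 0 ∧
      ∀ t, 0 ≤ t → |f t - θ₀| < Real.pi / 2 ∧ |g t - θ₀| < Real.pi / 2 := by
  set L : ℝ → ℝ := fun s => (1 - s) * f 0 + s * g 0
  have h1 := isPreconnected_Ici.image f hf
  have h2 := isPreconnected_Ici.image g hg
  have h3 : IsPreconnected (L '' Set.Icc 0 1) :=
    isPreconnected_Icc.image L (Continuous.continuousOn (by fun_prop))
  have hL0 : f 0 ∈ L '' Set.Icc 0 1 := ⟨0, by simp, by simp [L]⟩
  have hL1 : g 0 ∈ L '' Set.Icc 0 1 := ⟨1, by simp, by simp [L]⟩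
  -- The segment from f 0 to g 0 joins the two images into one preconnected set, so a single branch
  -- serves both.
  have h4 := (h1.union (f 0) (Set.mem_image_of_mem f Set.self_mem_Ici) hL0 h3).union (g 0)
    (Or.inr hL1) (Set.mem_image_of_mem g Set.self_mem_Ici) h2
  obtain ⟨θ₀, h0, h⟩ := exists_branch h4 (by
    rintro _ ((⟨t, ht, rfl⟩ | ⟨s, hs', rfl⟩) | ⟨t, ht, rfl⟩)
    exacts [hf0 t ht, hs s hs', hg0 t ht])
  exact ⟨θ₀, h0, fun t ht => ⟨h _ (Or.inl (Or.inl ⟨t, ht, rfl⟩)), h _ (Or.inr ⟨t, ht, rfl⟩)⟩⟩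

theorem cos_ne_zero_of_coupling_pos {a b : ℝ} {v : Fin 4 → ℝ} (hκ : 0 < coupling a b v)
    (hS : SymmetryCondition a b v) : Real.cos (v 0 - v 2) ≠ 0 ∧ Real.cos (v 1 - v 3) ≠ 0 := by
  simp only [coupling, SymmetryCondition] at hκ hS
  constructor <;> intro h <;> rw [h] at hκ hS <;> linarith

theorem abs_sub_lt_of_mem_Theta {γ : ℝ} {v : Fin 4 → ℝ} (hv : v ∈ Theta γ) :
    |v 0 - v 2| < γ ∧ |v 1 - v 3| < γ := by
  rw [Theta, Set.mem_ofPred_eq, incidence_transpose_mulVec] at hv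
  exact ⟨(norm_le_pi_norm _ (1 : Fin 6)).trans_lt hv, (norm_le_pi_norm _ (4 : Fin 6)).trans_lt hv⟩

theorem coupling_pos_of_mem_Theta {a b : ℝ} (ha : 0 < a) (hb : 0 < b) {v : Fin 4 → ℝ}
    (hv : v ∈ Theta (Real.pi / 2)) : 0 < coupling a b v := by
  obtain ⟨h1, h2⟩ := abs_sub_lt_of_mem_Theta hv
  exact add_pos (mul_pos ha (Real.cos_pos_of_mem_Ioo (abs_lt.1 h1)))
    (mul_pos hb (Real.cos_pos_of_mem_Ioo (abs_lt.1 h2)))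

theorem cohesiveIndistinguishable {ω : Fin 4 → ℝ} {a b : ℝ} {w w' : Fin 6 → ℝ}
    (hw : CrossWeights a b w) (hw' : CrossWeights a b w') (ha : 0 < a) (hb : 0 < b) :
    CohesiveIndistinguishable ω a b w w' := by
  intro x x' hx hx' hc hc' hS hS'
  refine equalUpToPhaseShift hx hx' hw hw' (commonTriangle_of_branches Real.sin_zero Real.sin_zero
    (fun t ht => ?_) (fun t ht => ?_) hS hS' (coupling_pos_of_mem_Theta ha hb (hc 0 le_rfl)))
  · rw [sub_zero, sub_zero]
    exact ⟨(abs_sub_lt_of_mem_Theta (hc t ht)).1, (abs_sub_lt_of_mem_Theta (hc' t ht)).1⟩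
  · rw [sub_zero, sub_zero]
    exact ⟨(abs_sub_lt_of_mem_Theta (hc t ht)).2, (abs_sub_lt_of_mem_Theta (hc' t ht)).2⟩

/-- The intermediate solutions enter only at time 0: their initial states form the segment that puts
both trajectories on a common branch. -/
theorem auxiliaryIndistinguishable {ω : Fin 4 → ℝ} {a b : ℝ} {w w' : Fin 6 → ℝ}
    (hw : CrossWeights a b w) (hw' : CrossWeights a b w') :
    AuxiliaryIndistinguishable ω a b w w' := by
  intro X hX hκS
  have m0 : (0 : ℝ) ∈ Set.Icc (0 : ℝ) 1 := by simp
  have m1 : (1 : ℝ) ∈ Set.Icc (0 : ℝ) 1 := by simp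
  have hx : IsTrajectory ω w (X 0) := by simpa using (hX 0 m0).1
  have hx' : IsTrajectory ω w' (X 1) := by simpa using (hX 1 m1).1
  have hcont : ∀ {w : Fin 6 → ℝ} {x : ℝ → Fin 4 → ℝ} (i j : Fin 4), IsTrajectory ω w x →
      ContinuousOn (fun t => x t i - x t j) (Set.Ici 0) := fun i j h t ht =>
    ((h.apply ht i).sub (h.apply ht j)).continuousWithinAt
  have hne := fun s hs t ht => cos_ne_zero_of_coupling_pos (hκS s hs t ht).1 (hκS s hs t ht).2
  have hinit : ∀ s ∈ Set.Icc (0 : ℝ) 1, ∀ i j, X s 0 i - X s 0 j =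
      (1 - s) * (X 0 0 i - X 0 0 j) + s * (X 1 0 i - X 1 0 j) := fun s hs i j => by
    rw [(hX s hs).2]
    simp only [Pi.add_apply, Pi.smul_apply, smul_eq_mul]
    ring
  obtain ⟨α₀, hα₀, hα⟩ := exists_common_branch (hcont 0 2 hx) (hcont 0 2 hx')
    (fun t ht => (hne 0 m0 t ht).1) (fun t ht => (hne 1 m1 t ht).1)
    (fun s hs => by rw [← hinit s hs]; exact (hne s hs 0 le_rfl).1)
  obtain ⟨β₀, hβ₀, hβ⟩ := exists_common_branch (hcont 1 3 hx) (hcont 1 3 hx')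
    (fun t ht => (hne 0 m0 t ht).2) (fun t ht => (hne 1 m1 t ht).2)
    (fun s hs => by rw [← hinit s hs]; exact (hne s hs 0 le_rfl).2)
  exact equalUpToPhaseShift hx hx' hw hw' (commonTriangle_of_branches hα₀ hβ₀ hα hβ
    (fun t ht => (hκS 0 m0 t ht).2) (fun t ht => (hκS 1 m1 t ht).2) (hκS 0 m0 0 le_rfl).1)

/-! ### The linearization -/

/-- The Jacobian matrix of the vector field with weights `w`. -/
noncomputable def linearization (w : Fin 6 → ℝ) (x : Fin 4 → ℝ) : Matrix (Fin 4) (Fin 4) ℝ :=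
  -(incidence * Matrix.diagonal (fun e => w e * Real.cos (incidence.transpose.mulVec x e)) *
    incidence.transpose)

theorem hasFDerivAt_field (ω : Fin 4 → ℝ) (w : Fin 6 → ℝ) (x : Fin 4 → ℝ) :
    HasFDerivAt (field ω w) (LinearMap.toContinuousLinearMap
      (Matrix.toLin' (linearization w x))) x := by
  have h1 : HasFDerivAt (fun x => incidence.transpose.mulVec x)
      (LinearMap.toContinuousLinearMap (Matrix.toLin' incidence.transpose)) x :=
    (LinearMap.toContinuousLinearMap (Matrix.toLin' incidence.transpose)).hasFDerivAt
  have h2 := hasFDerivAt_pi.2 fun e => (hasFDerivAt_pi'.1 h1 e).sin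
  have h3 := ((LinearMap.toContinuousLinearMap (Matrix.toLin'
    (incidence * Matrix.diagonal w))).hasFDerivAt.comp x h2).const_sub ω
  have h4 : field ω w = fun x => ω - LinearMap.toContinuousLinearMap (Matrix.toLin'
      (incidence * Matrix.diagonal w)) (fun e => Real.sin (incidence.transpose.mulVec x e)) := by
    ext x : 1
    simp [field, Matrix.mulVec_mulVec]
  rw [h4]
  refine h3.congr_fderiv ?_
  ext1 v
  simp only [linearization, map_neg, neg_apply,
    ContinuousLinearMap.comp_apply, LinearMap.coe_toContinuousLinearMap', Matrix.toLin'_apply,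
    ← Matrix.mulVec_mulVec]
  congr 2
  ext e
  simp [Matrix.mulVec_diagonal]
  ring

theorem jacobian_of_hasFDerivAt {n : ℕ} {f : (Fin n → ℝ) → (Fin n → ℝ)}
    {J : Matrix (Fin n) (Fin n) ℝ} {x : Fin n → ℝ}
    (h : HasFDerivAt f (LinearMap.toContinuousLinearMap (Matrix.toLin' J)) x) :
    jacobian f x = J := by
  rw [jacobian, h.fderiv]
  simp

theorem linearization_add (w w' : Fin 6 → ℝ) (x : Fin 4 → ℝ) :
    linearization (w + w') x = linearization w x + linearization w' x := by
  rw [linearization, linearization, linearization, ← neg_add, ← Matrix.add_mul, ← Matrix.mul_add,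
    Matrix.diagonal_add]
  simp only [Pi.add_apply, add_mul]

theorem linearization_smul (s : ℝ) (w : Fin 6 → ℝ) (x : Fin 4 → ℝ) :
    linearization (s • w) x = s • linearization w x := by
  rw [linearization, linearization, smul_neg, ← Matrix.smul_mul, ← Matrix.mul_smul,
    ← Matrix.diagonal_smul]
  congr 4
  ext e
  simp [mul_assoc]

theorem hasFDerivAt_fieldDiff (ω : Fin 4 → ℝ) (w δ : Fin 6 → ℝ) (x : Fin 4 → ℝ) :
    HasFDerivAt (fieldDiff ω w δ) (LinearMap.toContinuousLinearMap
      (Matrix.toLin' (linearization δ x))) x := by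
  refine ((hasFDerivAt_field ω (w + δ) x).sub (hasFDerivAt_field ω w x)).congr_fderiv ?_
  rw [linearization_add, map_add, map_add, add_sub_cancel_left]

/-! ### The Jacobian as seen by the measurement -/

theorem obs_mul_linearization {a b : ℝ} {w : Fin 6 → ℝ} (hw : CrossWeights a b w)
    (x : Fin 4 → ℝ) : obs * linearization w x =
      !![-(a * Real.cos (x 0 - x 2)), -(b * Real.cos (x 1 - x 3)),
          a * Real.cos (x 0 - x 2), b * Real.cos (x 1 - x 3);
         a * Real.cos (x 0 - x 2), b * Real.cos (x 1 - x 3),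
         -(a * Real.cos (x 0 - x 2)), -(b * Real.cos (x 1 - x 3))] := by
  -- The columns of the edges 12 and 34 vanish, so perturbing their weights has no effect on the
  -- measured rows.
  have h1 : obs * incidence = !![0, 1, 1, 1, 1, 0; 0, -1, -1, -1, -1, 0] := by
    ext i j
    fin_cases i <;> fin_cases j <;> simp [obs, incidence, Matrix.mul_apply, Fin.sum_univ_four]
  rw [linearization, Matrix.mul_neg, ← Matrix.mul_assoc, ← Matrix.mul_assoc, h1,
    incidence_transpose_mulVec]
  ext i j
  rw [Matrix.neg_apply, Matrix.mul_apply]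
  simp only [Matrix.mul_diagonal, Fin.sum_univ_six, incidence, Matrix.transpose_apply]
  fin_cases i <;> fin_cases j <;> simp [hw.w13, hw.w14, hw.w23, hw.w24]

theorem pseudoinverse_obs :
    pseudoinverse obs = !![1 / 2, 0; 1 / 2, 0; 0, 1 / 2; 0, 1 / 2] := by
  have h1 : (obs * obs.transpose)⁻¹ = (1 / 2 : ℝ) • (1 : Matrix (Fin 2) (Fin 2) ℝ) := by
    refine Matrix.inv_eq_left_inv ?_
    rw [Matrix.smul_mul, one_mul]
    ext i j
    rw [Matrix.smul_apply, Matrix.mul_apply, Fin.sum_univ_four]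
    fin_cases i <;> fin_cases j <;> simp [obs, Matrix.transpose_apply] <;>
      norm_num [Matrix.cons_val]
  rw [pseudoinverse, h1]
  ext i j
  fin_cases i <;> fin_cases j <;> simp [obs]

theorem obs_linearization_pseudoinverse {a b : ℝ} {w : Fin 6 → ℝ} (hw : CrossWeights a b w)
    (x : Fin 4 → ℝ) : obs * linearization w x * pseudoinverse obs =
      (1 / 2 * coupling a b x) • !![-1, 1; 1, -1] := by
  rw [obs_mul_linearization hw, pseudoinverse_obs]
  ext i j
  fin_cases i <;> fin_cases j <;>
    simp [Matrix.mul_apply, Fin.sum_univ_four, coupling] <;> ring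

theorem existsUnique_neg_eigenvalue {k : ℝ} (hk : 0 < k) :
    ∃! l : ℝ, l < 0 ∧ Module.End.HasEigenvalue
      (Matrix.toLin' (k • !![-1, 1; 1, -1] : Matrix (Fin 2) (Fin 2) ℝ)) l := by
  refine ⟨-2 * k, ⟨by linarith, ?_⟩, ?_⟩
  · refine Module.End.hasEigenvalue_of_hasEigenvector (x := ![1, -1])
      ⟨Module.End.mem_eigenspace_iff.2 ?_, fun h => by simpa using congrFun h 0⟩
    ext i
    fin_cases i <;> simp [Matrix.toLin'_apply, Matrix.mulVec, dotProduct, Fin.sum_univ_two] <;> ring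
  · rintro l ⟨hl, h⟩
    obtain ⟨v, hv⟩ := h.exists_hasEigenvector
    have h0 := congrFun hv.apply_eq_smul 0
    have h1 := congrFun hv.apply_eq_smul 1
    simp [Matrix.toLin'_apply, Matrix.mulVec, dotProduct, Fin.sum_univ_two] at h0 h1
    have hsum : v 1 = -v 0 := by
      -- The columns of the matrix sum to zero, so an eigenvector of nonzero eigenvalue has
      -- vanishing coordinate sum.
      have : l * (v 0 + v 1) = 0 := by linear_combination -h0 - h1
      linarith [(mul_eq_zero.1 this).resolve_left hl.ne]
    rw [hsum] at h0
    have h2 : (l + 2 * k) * v 0 = 0 := by linear_combination -h0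
    rcases mul_eq_zero.1 h2 with h3 | h3
    · linarith
    · refine absurd ?_ hv.2
      ext i
      fin_cases i <;> simp [hsum, h3]

theorem ker_smul_laplacian {k : ℝ} (hk : k ≠ 0) :
    LinearMap.ker (Matrix.toLin' (k • !![-1, 1; 1, -1] : Matrix (Fin 2) (Fin 2) ℝ)) =
      Submodule.span ℝ {fun _ => (1 : ℝ)} := by
  ext v
  rw [LinearMap.mem_ker, Submodule.mem_span_singleton]
  constructor
  · intro h
    have h0 := congrFun h 0
    simp [Matrix.toLin'_apply, Matrix.mulVec, dotProduct, Fin.sum_univ_two] at h0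
    have h1 : k * (v 1 - v 0) = 0 := by linear_combination h0
    have h2 := (mul_eq_zero.1 h1).resolve_left hk
    refine ⟨v 0, ?_⟩
    ext i
    fin_cases i
    · simp
    · simp; linarith
  · rintro ⟨c, rfl⟩
    ext i
    fin_cases i <;> simp [Matrix.toLin'_apply, dotProduct, Fin.sum_univ_two]

theorem ker_obs_le {a b : ℝ} {w : Fin 6 → ℝ} (hw : CrossWeights a b w) {x : Fin 4 → ℝ}
    (hS : SymmetryCondition a b x) : LinearMap.ker (Matrix.toLin' obs) ≤
      LinearMap.ker (Matrix.toLin' (obs * linearization w x)) := by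
  intro v hv
  rw [LinearMap.mem_ker, Matrix.toLin'_apply] at hv ⊢
  rw [obs_mulVec] at hv
  have h0 := congrFun hv 0
  have h1 := congrFun hv 1
  simp only [Matrix.cons_val_zero, Matrix.cons_val_one, Pi.zero_apply] at h0 h1
  rw [SymmetryCondition] at hS
  rw [obs_mul_linearization hw, ← hS]
  ext i
  fin_cases i <;> simp [Matrix.mulVec, dotProduct, Fin.sum_univ_four]
  · linear_combination a * Real.cos (x 0 - x 2) * (h1 - h0)
  · linear_combination a * Real.cos (x 0 - x 2) * (h0 - h1)

theorem obs_transpose_mul_centering_mul_obs : obs.transpose * centering 2 * obs =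
    (1 / 2 : ℝ) • Matrix.vecMulVec ![1, 1, -1, -1] ![1, 1, -1, -1] := by
  ext i j
  fin_cases i <;> fin_cases j <;>
    norm_num [obs, centering, Matrix.mul_apply, Fin.sum_univ_two, Matrix.vecMulVec_apply]

theorem centering_posSemidef : (centering 2).PosSemidef := by
  have : centering 2 = (1 / 2 : ℝ) • Matrix.vecMulVec ![1, -1] (star ![1, -1]) := by
    ext i j
    fin_cases i <;> fin_cases j <;> norm_num [centering, Matrix.vecMulVec_apply]
  rw [this]
  exact (Matrix.posSemidef_vecMulVec_self_star _).smul (by norm_num)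

/-- Under the symmetry condition (1, 1, -1, -1) is a left eigenvector of the Jacobian with
eigenvalue -κ, and M_C is half its outer square. The contraction inequality thus reduces to κ - μ ≥
0. -/
theorem observed_mul_linearization {a b : ℝ} {w : Fin 6 → ℝ} (hw : CrossWeights a b w)
    {x : Fin 4 → ℝ} (hS : SymmetryCondition a b x) :
    obs.transpose * centering 2 * obs * linearization w x =
      -coupling a b x • (obs.transpose * centering 2 * obs) := by
  rw [Matrix.mul_assoc, obs_mul_linearization hw, coupling]
  rw [SymmetryCondition] at hS
  rw [← hS]
  ext i j
  fin_cases i <;> fin_cases j <;>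
    simp [obs, centering, Matrix.mul_apply, Fin.sum_univ_two, Matrix.vecMulVec_apply] <;> ring

theorem contractionLMI_of_symmetry {ω : Fin 4 → ℝ} {a b : ℝ} {w δ : Fin 6 → ℝ} {s : ℝ}
    (hw : CrossWeights a b (w + s • δ)) {x : Fin 4 → ℝ} (hS : SymmetryCondition a b x) {μ : ℝ}
    (hμ : μ ≤ coupling a b x) :
    ContractionLMI (field ω w) (fieldDiff ω w δ) obs (centering 2) μ s x := by
  have hMC := obs_transpose_mul_centering_mul_obs
  have hA := observed_mul_linearization hw hS
  rw [ContractionLMI, jacobian_of_hasFDerivAt (hasFDerivAt_field ω w x),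
    jacobian_of_hasFDerivAt (hasFDerivAt_fieldDiff ω w δ x)]
  rw [linearization_add, linearization_smul] at hA
  set MC := obs.transpose * centering 2 * obs
  have hsymm : MC.transpose = MC := by
    rw [hMC, Matrix.transpose_smul, Matrix.transpose_vecMulVec]
  have hA' := congrArg Matrix.transpose hA
  rw [Matrix.transpose_mul, Matrix.transpose_smul, hsymm, Matrix.transpose_add,
    Matrix.transpose_smul, Matrix.add_mul, Matrix.smul_mul] at hA'
  rw [Matrix.mul_add, Matrix.mul_smul] at hA
  have : (-2 * μ) • MC - ((linearization w x).transpose * MC + MC * linearization w x +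
      s • ((linearization δ x).transpose * MC + MC * linearization δ x)) =
      (coupling a b x - μ) • Matrix.vecMulVec ![1, 1, -1, -1] (star ![1, 1, -1, -1]) := by
    rw [smul_add, add_add_add_comm, hA, hA', hMC, star_trivial]
    module
  rw [this]
  exact (Matrix.posSemidef_vecMulVec_self_star _).smul (sub_nonneg.2 hμ)

/-! ### The four topologies -/

theorem crossWeights_net (a12 a13 a24 a34 : ℝ) (k : Fin 4) :
    CrossWeights a13 a24 (net a12 a13 a24 a34 k) := by
  fin_cases k <;> constructor <;> simp [net, weights]

theorem topology_connected_iff {a12 a13 a24 a34 : ℝ} (h12 : a12 ≠ 0) (h34 : a34 ≠ 0)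
    (h13 : a13 ≠ 0) (h24 : a24 ≠ 0) (k : Fin 4) :
    (topology (net a12 a13 a24 a34 k)).Connected ↔ k ≠ 3 := by
  constructor
  · rintro h rfl
    -- With both 12 and 34 deleted, no edge leaves the node set {1, 3}, here {0, 2}.
    have hadj : ∀ i j : Fin 4, (topology (net a12 a13 a24 a34 3)).Adj i j →
        (i = 0 ∨ i = 2) → (j = 0 ∨ j = 2) := by
      rintro i j ⟨-, e, he, hi, hj⟩
      fin_cases e <;> fin_cases i <;> fin_cases j <;> simp_all [net, weights, incidence]
    have hreach : ∀ i j : Fin 4, (topology (net a12 a13 a24 a34 3)).Reachable i j →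
        (i = 0 ∨ i = 2) → (j = 0 ∨ j = 2) := by
      rintro i j ⟨p⟩
      induction p with
      | nil => exact id
      | cons hij _ ih => exact fun hi => ih (hadj _ _ hij hi)
    simpa using hreach 0 1 (h.preconnected 0 1) (Or.inl rfl)
  · intro hk
    set G := topology (net a12 a13 a24 a34 k)
    have e02 : G.Adj 0 2 := ⟨by decide, 1, by simpa [(crossWeights_net a12 a13 a24 a34 k).w13],
      by simp [incidence], by simp [incidence]⟩
    have e13 : G.Adj 1 3 := ⟨by decide, 4, by simpa [(crossWeights_net a12 a13 a24 a34 k).w24],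
      by simp [incidence], by simp [incidence]⟩
    have e01 : G.Reachable 0 1 := by
      by_cases hw : net a12 a13 a24 a34 k 0 = 0
      · have h5 : net a12 a13 a24 a34 k 5 ≠ 0 := by
          fin_cases k <;> simp_all [net, weights]
        have e23 : G.Adj 2 3 := ⟨by decide, 5, h5, by simp [incidence], by simp [incidence]⟩
        exact e02.reachable.trans (e23.reachable.trans e13.reachable.symm)
      · exact SimpleGraph.Adj.reachable ⟨by decide, 0, hw, by simp [incidence], by simp [incidence]⟩
    have h0 : ∀ i, G.Reachable 0 i := by
      intro i
      fin_cases i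
      exacts [SimpleGraph.Reachable.refl _, e01, e02.reachable, e01.trans e13.reachable]
    exact ⟨fun i j => (h0 i).symm.trans (h0 j)⟩

end KuramotoFour

theorem mainTheorem4 (ω : Fin 4 → ℝ) (a12 a13 a24 a34 : ℝ) :
    -- the matrix `M = I - (1/2) 𝟙 𝟙ᵀ` and its matrix equation
    ((centering 2).PosSemidef ∧
      (!![-1, 1; 1, -1] : Matrix (Fin 2) (Fin 2) ℝ).transpose * centering 2 +
        centering 2 * !![-1, 1; 1, -1] = (-4 : ℝ) • centering 2) ∧
    -- phase cohesiveness gives positivity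
    (0 < a13 → 0 < a24 → ∀ x ∈ Theta (Real.pi / 2), 0 < coupling a13 a24 x) ∧
    -- arbitrary perturbations of the edges 12 and 34
    (∀ δ : Fin 6 → ℝ, δ 1 = 0 → δ 2 = 0 → δ 3 = 0 → δ 4 = 0 →
      let f := field ω (weights a12 a13 a24 a34)
      let Δ := fieldDiff ω (weights a12 a13 a24 a34) δ
      (∀ x, obs.mulVec (Δ x) = 0) ∧
      Differentiable ℝ f ∧ Differentiable ℝ Δ ∧
      (∀ s ∈ Set.Icc (0 : ℝ) 1, ∀ x : Fin 4 → ℝ,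
        let A := jacobian f x + s • jacobian Δ x
        let P := obs * A * pseudoinverse obs
        P = (1 / 2 * coupling a13 a24 x) • !![-1, 1; 1, -1] ∧
        (0 < coupling a13 a24 x →
          (∃! l : ℝ, l < 0 ∧ Module.End.HasEigenvalue (Matrix.toLin' P) l) ∧
          LinearMap.ker (Matrix.toLin' P) = Submodule.span ℝ {fun _ => (1 : ℝ)}) ∧
        (SymmetryCondition a13 a24 x →
          LinearMap.ker (Matrix.toLin' obs) ≤ LinearMap.ker (Matrix.toLin' (obs * A))) ∧
        (0 < coupling a13 a24 x → SymmetryCondition a13 a24 x →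
          ∀ μ ≤ coupling a13 a24 x, ContractionLMI f Δ obs (centering 2) μ s x)) ∧
      AuxiliaryIndistinguishable ω a13 a24
        (weights a12 a13 a24 a34) (weights a12 a13 a24 a34 + δ) ∧
      (0 < a13 → 0 < a24 → CohesiveIndistinguishable ω a13 a24
        (weights a12 a13 a24 a34) (weights a12 a13 a24 a34 + δ))) ∧
    -- the four networks, the last of which is disconnected
    (a12 ≠ 0 → a34 ≠ 0 → 0 < a13 → 0 < a24 →
      (∀ k, (topology (net a12 a13 a24 a34 k)).Connected ↔ k ≠ 3) ∧
      ∀ i j,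
        AuxiliaryIndistinguishable ω a13 a24
          (net a12 a13 a24 a34 i) (net a12 a13 a24 a34 j) ∧
        CohesiveIndistinguishable ω a13 a24
          (net a12 a13 a24 a34 i) (net a12 a13 a24 a34 j)) := by
  refine ⟨⟨centering_posSemidef, ?_⟩, fun ha hb x hx => coupling_pos_of_mem_Theta ha hb hx,
    fun δ d1 d2 d3 d4 => ?_, fun h12 h34 ha hb => ⟨topology_connected_iff h12 h34 ha.ne' hb.ne',
      fun i j => ⟨auxiliaryIndistinguishable (crossWeights_net _ _ _ _ i)
          (crossWeights_net _ _ _ _ j),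
        cohesiveIndistinguishable (crossWeights_net _ _ _ _ i) (crossWeights_net _ _ _ _ j) ha hb⟩⟩⟩
  · ext i j
    fin_cases i <;> fin_cases j <;>
      norm_num [centering, Matrix.mul_apply, Fin.sum_univ_two, Matrix.vecMulVec_apply]
  have hw : CrossWeights a13 a24 (weights a12 a13 a24 a34) := by
    constructor <;> simp [weights]
  have hws : ∀ s : ℝ, CrossWeights a13 a24 (weights a12 a13 a24 a34 + s • δ) := fun s => by
    constructor <;> simp [weights, d1, d2, d3, d4]
  have hw' : CrossWeights a13 a24 (weights a12 a13 a24 a34 + δ) := by simpa using hws 1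
  intro f Δ
  refine ⟨fun x => ?_, fun x => (hasFDerivAt_field ω _ x).differentiableAt,
    fun x => (hasFDerivAt_fieldDiff ω _ δ x).differentiableAt, fun s _ x => ?_,
    auxiliaryIndistinguishable hw hw', cohesiveIndistinguishable hw hw'⟩
  · change obs.mulVec (field ω _ x - field ω _ x) = 0
    rw [Matrix.mulVec_sub, obs_mulVec_field ω hw, obs_mulVec_field ω hw', sub_self]
  intro A P
  -- The Jacobian is linear in the weights, so the auxiliary system at s linearizes like the network
  -- with weights w + sδ.
  have hA : A = linearization (weights a12 a13 a24 a34 + s • δ) x := by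
    rw [linearization_add, linearization_smul,
      ← jacobian_of_hasFDerivAt (hasFDerivAt_field ω (weights a12 a13 a24 a34) x),
      ← jacobian_of_hasFDerivAt (hasFDerivAt_fieldDiff ω (weights a12 a13 a24 a34) δ x)]
  have hP : P = (1 / 2 * coupling a13 a24 x) • !![-1, 1; 1, -1] := by
    rw [← obs_linearization_pseudoinverse (hws s), ← hA]
  refine ⟨hP, fun hκ => ?_, fun hS => ?_, fun _ hS μ hμ => contractionLMI_of_symmetry (hws s) hS hμ⟩
  · have hk : 0 < 1 / 2 * coupling a13 a24 x := by linarith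
    rw [hP]
    exact ⟨existsUnique_neg_eigenvalue hk, ker_smul_laplacian hk.ne'⟩
  · rw [hA]
    exact ker_obs_le (hws s) hS
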